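/- Let $n\in\mathbb N$, let $|\cdot|$ be the Euclidean norm on $\mathbb R^n$, and let $\mathcal K^n$ be the set of non-empty compact convex subsets of $\mathbb R^n$ with the Hausdorff metric $d_H$. For $K,L\in\mathcal K^n\cup\{\emptyset\}$ put $$\hat d_H(K,L)=\begin{cases} d_H(K,L) & K\neq\emptyset\neq L,\\ 0 & K=L=\emptyset,\\ \max\{1,d_H(K,\{0\})\} & K\neq\emptyset,\ L=\emptyset,\\ \max\{1,d_H(L,\{0\})\} & K=\emptyset,\ L\neq\emptyset.\end{cases}$$ Let $\mathrm{CV}_c$ be the set of all functions $u:\mathbb R^n\to\mathbb R\cup\{+\infty\}$ that are convex, lower semicontinuous, proper ($u\not\equiv+\infty$) and coercive ($\lim_{|x|\to\infty}u(x)=+\infty$). A sequence $u_k\in\mathrm{CV}_c$ epi-converges to $u\in\mathrm{CV}_c$ if for every $x\in\mathbb R^n$ one has $\liminf_k u_k(x_k)\ge u(x)$ for every sequence $x_k\to x$, and $\limsup_k u_k(x_k)\le u(x)$ for some sequence $x_k\to x$. For a continuous, decreasing (not necessarily strictly) $\zeta:\mathbb R\to[0,\infty)$ with $\int_0^\infty\zeta(t)\,dt<\infty$,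 set $\zeta(+\infty):=0$ and $$\delta^H_\zeta(u,v)=\int_0^\infty \hat d_H\big(\{x:\zeta(u(x))\ge s\},\{x:\zeta(v(x))\ge s\}\big)\,ds,\qquad u,v\in\mathrm{CV}_c.$$ Then: 1. $\hat d_H$ is a metric on $\mathcal K^n\cup\{\emptyset\}$ that extends $d_H$. 2. Let $\zeta:\mathbb R\to[0,\infty)$ be continuous and decreasing with $\int_0^\infty\zeta(t)\,dt<\infty$. Then for all $u\in\mathrm{CV}_c$ and $s>0$ the set $\{\zeta\circ u\ge s\}$ belongs to $\mathcal K^n\cup\{\emptyset\}$, for all $u,v\in\mathrm{CV}_c$ the integrand in $\delta^H_\zeta(u,v)$ is integrable over $(0,\infty)$ (so $\delta^H_\zeta(u,v)<\infty$), and if $u_k,u\in\mathrm{CV}_c$ and $u_k$ epi-converges to $u$, then $\delta^H_\zeta(u_k,u)\to0$. 3. Let $\zeta:\mathbb R\to(0,\infty)$ be continuous and strictly decreasing with $\int_0^\infty\zeta(t)\,dt<\infty$. Then $\delta^H_\zeta$ is a metric on $\mathrm{CV}_c$, and for all $u_k,u\in\mathrm{CV}_c$ one has $\delta^H_\zeta(u_k,u)\to0$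 as $k\to\infty$ if and only if $u_k$ epi-converges to $u$. -/

import Mathlib

open Filter Topology MeasureTheory

noncomputable section

/-- Proper, lower semicontinuous, coercive, convex functions `u : ℝⁿ → ℝ ∪ {+∞}`. Values lie in
`EReal` with `-∞` excluded; convexity is convexity of the epigraph. -/
structure IsCoerciveConvex {n : ℕ} (u : EuclideanSpace ℝ (Fin n) → EReal) : Prop where
  ne_bot : ∀ x, u x ≠ ⊥
  proper : ∃ x, u x ≠ ⊤
  lsc : LowerSemicontinuous u
  convex : Convex ℝ {p : EuclideanSpace ℝ (Fin n) × ℝ | u p.1 ≤ (p.2 : EReal)}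
  coercive : Tendsto u (Bornology.cobounded (EuclideanSpace ℝ (Fin n))) (𝓝 ⊤)

/-- The space of proper, lower semicontinuous, coercive, convex functions on `ℝⁿ`. -/
def CVc (n : ℕ) : Type :=
  {u : EuclideanSpace ℝ (Fin n) → EReal // IsCoerciveConvex u}

/-- Epi-convergence of a sequence of functions. -/
def EpiConverges {n : ℕ} (w : ℕ → EuclideanSpace ℝ (Fin n) → EReal)
    (u : EuclideanSpace ℝ (Fin n) → EReal) : Prop :=
  ∀ x : EuclideanSpace ℝ (Fin n),
    (∀ y : ℕ → EuclideanSpace ℝ (Fin n), Tendsto y atTop (𝓝 x) →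
      u x ≤ liminf (fun k => w k (y k)) atTop) ∧
    (∃ y : ℕ → EuclideanSpace ℝ (Fin n), Tendsto y atTop (𝓝 x) ∧
      limsup (fun k => w k (y k)) atTop ≤ u x)

/-- Compact convex subsets of `ℝⁿ`, i.e. the convex bodies together with the empty set. -/
def CompactConvex (n : ℕ) : Type :=
  {K : Set (EuclideanSpace ℝ (Fin n)) // IsCompact K ∧ Convex ℝ K}

open Classical in
/-- The extension of the Hausdorff distance to the empty set. -/
def hatDH {n : ℕ} (K L : Set (EuclideanSpace ℝ (Fin n))) : ℝ :=
  if K = ∅ then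
    if L = ∅ then 0 else max 1 (Metric.hausdorffDist L {0})
  else
    if L = ∅ then max 1 (Metric.hausdorffDist K {0}) else Metric.hausdorffDist K L

open Classical in
/-- `ζ` extended by `ζ(+∞) = 0`; the value at `-∞` is irrelevant, since functions in `CVc n` do not
take it. -/
def zetaExt (ζ : ℝ → ℝ) (y : EReal) : ℝ :=
  if y = ⊤ then 0 else ζ y.toReal

/-- The superlevel set `{ζ ∘ u ≥ s}`. -/
def superlevel {n : ℕ} (ζ : ℝ → ℝ) (u : EuclideanSpace ℝ (Fin n) → EReal) (s : ℝ) :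
    Set (EuclideanSpace ℝ (Fin n)) :=
  {x | s ≤ zetaExt ζ (u x)}

/-- `∫₀^∞ hatDH {ζ ∘ u ≥ s} {ζ ∘ v ≥ s} ds`. -/
def deltaH {n : ℕ} (ζ : ℝ → ℝ) (u v : CVc n) : ℝ :=
  ∫ s in Set.Ioi (0 : ℝ), hatDH (superlevel ζ u.1 s) (superlevel ζ v.1 s)

end

/-! ### Hausdorff distance extended to the empty set. -/

section HausdorffExtension

variable {n : ℕ} {K L M : Set (EuclideanSpace ℝ (Fin n))}

/-! For `s > 0`, continuity and integrability of `ζ` leave two cases: either `{ζ ∘ u ≥ s}` is empty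
for every `u`, or it is the sublevel set `{u ≤ t}` for one `t` with `ζ t = s`, hence compact and
convex.

If `u_k` epi-converges to `u`, convexity and coercivity put a common cone `a‖x‖ - b` below `u` and
almost all `u_k` (`EpiConverges.exists_cone_le`). Their superlevel sets then lie in those of the
cone, whose radii are integrable in `s` by the layer-cake formula. At each level except the one
belonging to `min u`, sublevel sets converge (`EpiConverges.tendsto_hatDH_sublevel`), and dominated
convergence gives `δ → 0`. The same bound, for constant sequences, shows that `δ` is finite.

Conversely, if one of the two epi-convergence inequalities fails at a point, the superlevel sets
stay a fixed `ε ≤ 1` apart for all `s` between two values of `ζ`, and `mul_sub_le_deltaH` keeps `δ`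
away from `0`; strict monotonicity makes that interval nondegenerate. Constant sequences then give
definiteness of `δ`; its triangle inequality is that of `hatDH` integrated. -/

theorem hatDH_of_nonempty (hK : K.Nonempty) (hL : L.Nonempty) :
    hatDH K L = Metric.hausdorffDist K L := by
  simp [hatDH, hK.ne_empty, hL.ne_empty]

theorem hatDH_empty_right (hK : K.Nonempty) :
    hatDH K ∅ = max 1 (Metric.hausdorffDist K {0}) := by
  simp [hatDH, hK.ne_empty]

theorem hatDH_self (K : Set (EuclideanSpace ℝ (Fin n))) : hatDH K K = 0 := by
  by_cases h : K = ∅ <;> simp [hatDH, h, Metric.hausdorffDist_self_zero]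

theorem hatDH_comm (K L : Set (EuclideanSpace ℝ (Fin n))) : hatDH K L = hatDH L K := by
  unfold hatDH
  split_ifs <;> first | rfl | exact Metric.hausdorffDist_comm

theorem hatDH_nonneg (K L : Set (EuclideanSpace ℝ (Fin n))) : 0 ≤ hatDH K L := by
  unfold hatDH
  split_ifs
  · exact le_rfl
  · exact zero_le_one.trans (le_max_left _ _)
  · exact zero_le_one.trans (le_max_left _ _)
  · exact Metric.hausdorffDist_nonneg

theorem IsCompact.hausdorffEDist_ne_top (hK : IsCompact K) (hL : IsCompact L) (hK' : K.Nonempty)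
    (hL' : L.Nonempty) : Metric.hausdorffEDist K L ≠ ⊤ :=
  Metric.hausdorffEDist_ne_top_of_nonempty_of_bounded hK' hL' hK.isBounded hL.isBounded

/-- When an outer set is empty, this is the triangle inequality through `{0}` combined with
monotonicity of `max 1`. When only the middle set is empty, both terms on the right dominate
distances to `{0}`. -/
theorem hatDH_triangle (hK : IsCompact K) (hL : IsCompact L) (hM : IsCompact M) :
    hatDH K M ≤ hatDH K L + hatDH L M := by
  have h0 : IsCompact ({0} : Set (EuclideanSpace ℝ (Fin n))) := isCompact_singleton
  have h0' : ({0} : Set (EuclideanSpace ℝ (Fin n))).Nonempty := Set.singleton_nonempty 0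
  rcases K.eq_empty_or_nonempty with rfl | hK'
  · rcases M.eq_empty_or_nonempty with rfl | hM'
    · rw [hatDH_self]
      exact add_nonneg (hatDH_nonneg _ _) (hatDH_nonneg _ _)
    · rcases L.eq_empty_or_nonempty with rfl | hL'
      · simp [hatDH_self]
      · rw [hatDH_comm ∅ M, hatDH_comm ∅ L, hatDH_empty_right hM', hatDH_empty_right hL',
          hatDH_of_nonempty hL' hM']
        have h := Metric.hausdorffDist_triangle (u := {0})
          (hM.hausdorffEDist_ne_top hL hM' hL')
        rw [Metric.hausdorffDist_comm (s := M) (t := L)] at h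
        have h1 := le_max_left 1 (Metric.hausdorffDist L {0})
        have h2 := le_max_right 1 (Metric.hausdorffDist L {0})
        have h3 := Metric.hausdorffDist_nonneg (s := L) (t := M)
        exact max_le (by linarith) (by linarith)
  · rcases M.eq_empty_or_nonempty with rfl | hM'
    · rcases L.eq_empty_or_nonempty with rfl | hL'
      · simp [hatDH_self]
      · rw [hatDH_empty_right hK', hatDH_empty_right hL', hatDH_of_nonempty hK' hL']
        have h := Metric.hausdorffDist_triangle (u := {0})
          (hK.hausdorffEDist_ne_top hL hK' hL')
        have h1 := le_max_left 1 (Metric.hausdorffDist L {0})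
        have h2 := le_max_right 1 (Metric.hausdorffDist L {0})
        have h3 := Metric.hausdorffDist_nonneg (s := K) (t := L)
        exact max_le (by linarith) (by linarith)
    · rcases L.eq_empty_or_nonempty with rfl | hL'
      · rw [hatDH_comm ∅ M, hatDH_empty_right hK', hatDH_empty_right hM',
          hatDH_of_nonempty hK' hM']
        have h := Metric.hausdorffDist_triangle (u := M)
          (hK.hausdorffEDist_ne_top h0 hK' h0')
        rw [Metric.hausdorffDist_comm (s := {0}) (t := M)] at h
        have h1 := le_max_right 1 (Metric.hausdorffDist K {0})
        have h2 := le_max_right 1 (Metric.hausdorffDist M {0})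
        linarith
      · rw [hatDH_of_nonempty hK' hL', hatDH_of_nonempty hL' hM', hatDH_of_nonempty hK' hM']
        exact Metric.hausdorffDist_triangle (hK.hausdorffEDist_ne_top hL hK' hL')

theorem eq_of_hatDH_eq_zero (hK : IsCompact K) (hL : IsCompact L) (h : hatDH K L = 0) :
    K = L := by
  rcases K.eq_empty_or_nonempty with rfl | hK' <;> rcases L.eq_empty_or_nonempty with rfl | hL'
  · rfl
  · rw [hatDH_comm, hatDH_empty_right hL'] at h
    linarith [le_max_left 1 (Metric.hausdorffDist L {0})]
  · rw [hatDH_empty_right hK'] at h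
    linarith [le_max_left 1 (Metric.hausdorffDist K {0})]
  · rw [hatDH_of_nonempty hK' hL'] at h
    exact (hK.isClosed.hausdorffDist_zero_iff_eq hL.isClosed
      (hK.hausdorffEDist_ne_top hL hK' hL')).1 h

/-- The tool for bounding `deltaH` from below. The cap `ε ≤ 1` covers an empty `L`, whose distance
to `K` is only known to be at least `1`. -/
theorem le_hatDH (hK : IsCompact K) (hL : IsCompact L) {x : EuclideanSpace ℝ (Fin n)} {ε : ℝ}
    (hx : x ∈ K) (hε : ε ≤ 1) (h : ∀ y ∈ L, ε ≤ dist x y) : ε ≤ hatDH K L := by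
  have hK' : K.Nonempty := ⟨x, hx⟩
  rcases L.eq_empty_or_nonempty with rfl | hL'
  · rw [hatDH_empty_right hK']
    exact hε.trans (le_max_left _ _)
  · rw [hatDH_of_nonempty hK' hL']
    exact ((Metric.le_infDist hL').2 fun y hy => h y hy).trans
      (Metric.infDist_le_hausdorffDist_of_mem hx (hK.hausdorffEDist_ne_top hL hK' hL'))

theorem hatDH_le_of_subset_closedBall {r : ℝ} (hr : 0 ≤ r) (hK : K ⊆ Metric.closedBall 0 r)
    (hL : L ⊆ Metric.closedBall 0 r) : hatDH K L ≤ 1 + 2 * r := by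
  have key : ∀ A B : Set (EuclideanSpace ℝ (Fin n)), A ⊆ Metric.closedBall 0 r →
      B ⊆ Metric.closedBall 0 r → A.Nonempty → B.Nonempty →
      Metric.hausdorffDist A B ≤ 2 * r := by
    intro A B hA hB hA' hB'
    have hd : ∀ x ∈ A, ∀ y ∈ B, dist x y ≤ 2 * r := fun x hx y hy => by
      have h1 := Metric.mem_closedBall.1 (hA hx)
      have h2 := Metric.mem_closedBall.1 (hB hy)
      linarith [dist_triangle_right x y 0]
    obtain ⟨a, ha⟩ := hA'
    obtain ⟨b, hb⟩ := hB'
    exact Metric.hausdorffDist_le_of_mem_dist (by positivity) (fun x hx => ⟨b, hb, hd x hx b hb⟩)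
      fun y hy => ⟨a, ha, dist_comm a y ▸ hd a ha y hy⟩
  have h0 : ({0} : Set (EuclideanSpace ℝ (Fin n))) ⊆ Metric.closedBall 0 r := by
    simpa using hr
  have h0' : ({0} : Set (EuclideanSpace ℝ (Fin n))).Nonempty := Set.singleton_nonempty 0
  rcases K.eq_empty_or_nonempty with rfl | hK' <;> rcases L.eq_empty_or_nonempty with rfl | hL'
  · rw [hatDH_self]
    positivity
  · rw [hatDH_comm, hatDH_empty_right hL']
    exact max_le (by linarith) (by linarith [key L {0} hL h0 hL' h0'])
  · rw [hatDH_empty_right hK']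
    exact max_le (by linarith) (by linarith [key K {0} hK h0 hK' h0'])
  · rw [hatDH_of_nonempty hK' hL']
    linarith [key K L hK hL hK' hL']

theorem abs_infDist_sub_le_hausdorffDist (h : Metric.hausdorffEDist K L ≠ ⊤)
    (x : EuclideanSpace ℝ (Fin n)) :
    |Metric.infDist x K - Metric.infDist x L| ≤ Metric.hausdorffDist K L := by
  have h1 := Metric.infDist_le_infDist_add_hausdorffDist (x := x) h
  have h2 := Metric.infDist_le_infDist_add_hausdorffDist (x := x)
    (Metric.hausdorffEDist_comm (s := K) (t := L) ▸ h)
  rw [Metric.hausdorffDist_comm] at h2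
  exact abs_le.2 ⟨by linarith, by linarith⟩

/-- The Hausdorff distance is the sup norm of the difference of the distance functions; these are
continuous, so a dense sequence suffices. The countable supremum is what makes measurability
accessible. -/
theorem hausdorffDist_eq_iSup_denseSeq (hK : IsCompact K) (hL : IsCompact L) (hK' : K.Nonempty)
    (hL' : L.Nonempty) :
    Metric.hausdorffDist K L =
      ⨆ i, |Metric.infDist (TopologicalSpace.denseSeq (EuclideanSpace ℝ (Fin n)) i) K -
        Metric.infDist (TopologicalSpace.denseSeq (EuclideanSpace ℝ (Fin n)) i) L| := by
  set d := TopologicalSpace.denseSeq (EuclideanSpace ℝ (Fin n)) with hd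
  have hfin := hK.hausdorffEDist_ne_top hL hK' hL'
  have hbdd : BddAbove (Set.range fun i => |Metric.infDist (d i) K - Metric.infDist (d i) L|) :=
    ⟨_, Set.forall_mem_range.2 fun i => abs_infDist_sub_le_hausdorffDist hfin (d i)⟩
  apply le_antisymm
  · set r := ⨆ i, |Metric.infDist (d i) K - Metric.infDist (d i) L| with hr
    have hall : ∀ x, |Metric.infDist x K - Metric.infDist x L| ≤ r := by
      have hc : IsClosed {x | |Metric.infDist x K - Metric.infDist x L| ≤ r} :=
        isClosed_le (((Metric.continuous_infDist_pt K).sub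
          (Metric.continuous_infDist_pt L)).abs) continuous_const
      have hsub : Set.range d ⊆ {x | |Metric.infDist x K - Metric.infDist x L| ≤ r} :=
        Set.range_subset_iff.2 fun i => le_ciSup hbdd i
      intro x
      exact closure_minimal hsub hc
        ((TopologicalSpace.denseRange_denseSeq (EuclideanSpace ℝ (Fin n))) x)
    refine Metric.hausdorffDist_le_of_infDist ((abs_nonneg _).trans (hall 0)) ?_ ?_
    · intro x hx
      have := hall x
      rw [Metric.infDist_zero_of_mem hx] at this
      linarith [(abs_le.1 this).1]
    · intro x hx
      have := hall x
      rw [Metric.infDist_zero_of_mem hx] at this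
      linarith [(abs_le.1 this).2]
  · exact ciSup_le fun i => abs_infDist_sub_le_hausdorffDist hfin (d i)

end HausdorffExtension

/-! ### Measurability of the integrand. -/

section Measurability

variable {n : ℕ} {K L : ℝ → Set (EuclideanSpace ℝ (Fin n))}

theorem measurable_infDist_of_antitone (hK : Antitone K) (x : EuclideanSpace ℝ (Fin n)) :
    Measurable fun s => Metric.infDist x (K s) := by
  -- Monotonicity is available only for the extended distance: `infDist` drops to the default `0`
  -- once `K s` is empty.
  have h : Monotone fun s => Metric.infEDist x (K s) := fun s t hst => Metric.infEDist_anti (hK hst)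
  exact h.measurable.ennreal_toReal

theorem measurableSet_eq_empty_of_antitone (hK : Antitone K) : MeasurableSet {s | K s = ∅} := by
  apply Set.OrdConnected.measurableSet
  refine ⟨fun a ha b _ c hc => ?_⟩
  exact Set.subset_empty_iff.1 ((hK hc.1).trans_eq ha)

theorem aestronglyMeasurable_hatDH (hK : Antitone K) (hL : Antitone L)
    (hKc : ∀ s, 0 < s → IsCompact (K s)) (hLc : ∀ s, 0 < s → IsCompact (L s)) :
    AEStronglyMeasurable (fun s => hatDH (K s) (L s)) (volume.restrict (Set.Ioi 0)) := by
  classical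
  set D : Set (EuclideanSpace ℝ (Fin n)) → Set (EuclideanSpace ℝ (Fin n)) → ℝ := fun A B =>
    ⨆ i, |Metric.infDist (TopologicalSpace.denseSeq (EuclideanSpace ℝ (Fin n)) i) A -
      Metric.infDist (TopologicalSpace.denseSeq (EuclideanSpace ℝ (Fin n)) i) B| with hD
  have hDm : ∀ A B : ℝ → Set (EuclideanSpace ℝ (Fin n)), Antitone A → Antitone B →
      Measurable fun s => D (A s) (B s) := fun A B hA hB =>
    Measurable.iSup fun i => ((measurable_infDist_of_antitone hA _).sub
      (measurable_infDist_of_antitone hB _)).abs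
  have h0 : Antitone fun _ : ℝ => ({0} : Set (EuclideanSpace ℝ (Fin n))) := antitone_const
  have hm : Measurable fun s => if K s = ∅ then
      if L s = ∅ then 0 else max 1 (D (L s) {0})
    else if L s = ∅ then max 1 (D (K s) {0}) else D (K s) (L s) :=
    Measurable.ite (measurableSet_eq_empty_of_antitone hK)
      (Measurable.ite (measurableSet_eq_empty_of_antitone hL) measurable_const
        (measurable_const.max (hDm L _ hL h0)))
      (Measurable.ite (measurableSet_eq_empty_of_antitone hL)
        (measurable_const.max (hDm K _ hK h0)) (hDm K L hK hL))
  refine hm.aestronglyMeasurable.congr ?_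
  filter_upwards [ae_restrict_mem measurableSet_Ioi] with s hs
  unfold hatDH
  have hc0 : IsCompact ({0} : Set (EuclideanSpace ℝ (Fin n))) := isCompact_singleton
  have hn0 : ({0} : Set (EuclideanSpace ℝ (Fin n))).Nonempty := Set.singleton_nonempty 0
  split_ifs with h1 h2 h2
  · rfl
  · rw [hausdorffDist_eq_iSup_denseSeq (hLc s hs) hc0 (Set.nonempty_iff_ne_empty.2 h2) hn0]
  · rw [hausdorffDist_eq_iSup_denseSeq (hKc s hs) hc0 (Set.nonempty_iff_ne_empty.2 h1) hn0]
  · rw [hausdorffDist_eq_iSup_denseSeq (hKc s hs) (hLc s hs) (Set.nonempty_iff_ne_empty.2 h1)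
      (Set.nonempty_iff_ne_empty.2 h2)]

end Measurability

/-! ### Epi-convergence: cone bounds and sublevel sets. -/

section CoerciveConvex

variable {n : ℕ} {u : EuclideanSpace ℝ (Fin n) → EReal}
  {w : ℕ → EuclideanSpace ℝ (Fin n) → EReal}

theorem IsCoerciveConvex.le_combo (hu : IsCoerciveConvex u) {x y : EuclideanSpace ℝ (Fin n)}
    {p q a b : ℝ} (hx : u x ≤ p) (hy : u y ≤ q) (ha : 0 ≤ a) (hb : 0 ≤ b) (hab : a + b = 1) :
    u (a • x + b • y) ≤ ((a * p + b * q : ℝ) : EReal) :=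
  hu.convex (x := (x, p)) hx (y := (y, q)) hy ha hb hab

theorem IsCoerciveConvex.convex_sublevel (hu : IsCoerciveConvex u) (t : ℝ) :
    Convex ℝ {x | u x ≤ (t : EReal)} := by
  intro x hx y hy a b ha hb hab
  have h := hu.le_combo hx hy ha hb hab
  rwa [← add_mul, hab, one_mul] at h

theorem IsCoerciveConvex.isCompact_sublevel (hu : IsCoerciveConvex u) (t : ℝ) :
    IsCompact {x | u x ≤ (t : EReal)} := by
  apply Metric.isCompact_of_isClosed_isBounded (hu.lsc.isClosed_preimage _)
  have h := hu.coercive.eventually (lt_mem_nhds (EReal.coe_lt_top t))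
  rw [Filter.Eventually, ← Bornology.isBounded_compl_iff.trans Bornology.isCobounded_def] at h
  · refine h.subset fun x hx => ?_
    simpa using hx

/-- Every point of a sublevel set is a limit of points of the strict sublevel set, unless the
latter is empty. -/
theorem IsCoerciveConvex.exists_dist_lt (hu : IsCoerciveConvex u)
    {x z : EuclideanSpace ℝ (Fin n)} {t : ℝ} (hx : u x ≤ t) (hz : u z < t) {ε : ℝ} (hε : 0 < ε) :
    ∃ q, dist q x < ε ∧ u q < t := by
  obtain ⟨r, hr, hrt⟩ := EReal.lt_iff_exists_real_btwn.1 hz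
  have hrt' : r < t := EReal.coe_lt_coe_iff.1 hrt
  have hcont : Tendsto (fun a : ℝ => (1 - a) • x + a • z) (𝓝[>] 0) (𝓝 x) := by
    have : Continuous fun a : ℝ => (1 - a) • x + a • z := by fun_prop
    have h := (this.tendsto 0).mono_left (nhdsWithin_le_nhds (s := Set.Ioi (0 : ℝ)))
    simpa using h
  have h1 : ∀ᶠ a : ℝ in 𝓝[>] 0, a < 1 :=
    nhdsWithin_le_nhds (gt_mem_nhds zero_lt_one)
  obtain ⟨a, ⟨hdist, ha1⟩, ha0⟩ :=
    (((hcont.eventually (Metric.ball_mem_nhds x hε)).and h1).and self_mem_nhdsWithin).exists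
  refine ⟨_, hdist, (hu.le_combo hx hr.le (sub_nonneg.2 ha1.le) (le_of_lt ha0)
    (by ring)).trans_lt (EReal.coe_lt_coe_iff.2 ?_)⟩
  have ha0' : 0 < a := ha0
  nlinarith

/-- The lower bound in the definition of epi-convergence is uniform on compact sets. -/
theorem EpiConverges.eventually_forall_lt (h : EpiConverges w u)
    {C : Set (EuclideanSpace ℝ (Fin n))} (hC : IsCompact C) {c : EReal} (hc : ∀ x ∈ C, c < u x) :
    ∀ᶠ k in atTop, ∀ x ∈ C, c < w k x := by
  by_contra hcon
  rw [not_eventually] at hcon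
  obtain ⟨φ, hφ, hP⟩ := extraction_of_frequently_atTop hcon
  push Not at hP
  choose z hzC hz using hP
  obtain ⟨x, hx, ψ, hψ, hlim⟩ := hC.tendsto_subseq hzC
  have hinj : Function.Injective (φ ∘ ψ) := (hφ.comp hψ).injective
  -- The violating points exist only along a subsequence; filling the gaps with the limit `x` gives
  -- a full sequence to which the liminf inequality applies.
  set y : ℕ → EuclideanSpace ℝ (Fin n) := Function.extend (φ ∘ ψ) (z ∘ ψ) fun _ => x with hy
  have hyx : Tendsto y atTop (𝓝 x) := by
    rw [tendsto_def]
    intro U hU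
    obtain ⟨N, hN⟩ := eventually_atTop.1 (hlim.eventually hU)
    refine eventually_atTop.2 ⟨φ (ψ N), fun k hk => ?_⟩
    by_cases hkr : ∃ j, (φ ∘ ψ) j = k
    · obtain ⟨j, rfl⟩ := hkr
      have hj : N ≤ j := (hφ.comp hψ).le_iff_le.1 hk
      have e : y ((φ ∘ ψ) j) = (z ∘ ψ) j := hinj.extend_apply _ _ j
      rw [e]
      exact hN j hj
    · simpa [hy, Function.extend_apply' _ _ _ hkr] using mem_of_mem_nhds hU
  have hfreq : ∃ᶠ k in atTop, w k (y k) ≤ c := by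
    refine frequently_atTop.2 fun N => ⟨φ (ψ N), (hφ.comp hψ).id_le N, ?_⟩
    have : y (φ (ψ N)) = z (ψ N) := hinj.extend_apply _ _ N
    rw [this]
    exact hz (ψ N)
  exact (hc x hx).not_ge (((h x).1 y hyx).trans (liminf_le_of_frequently_le hfreq))

theorem EpiConverges.const (hu : LowerSemicontinuous u) : EpiConverges (fun _ => u) u := by
  refine fun x => ⟨fun y hy => ?_, fun _ => x, tendsto_const_nhds, by simp⟩
  refine le_of_forall_lt fun c hc => ?_
  obtain ⟨d, hcd, hdu⟩ := exists_between hc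
  exact hcd.trans_le (le_liminf_of_le (by isBoundedDefault)
    ((hy.eventually (hu x d hdu)).mono fun k hk => hk.le))

/-- An epi-convergent sequence is eventually bounded below by a common cone. -/
theorem EpiConverges.exists_cone_le (h : EpiConverges w u) (hw : ∀ k, IsCoerciveConvex (w k))
    (hu : IsCoerciveConvex u) :
    ∃ a : ℝ, 0 < a ∧ ∃ b : ℝ, ∀ᶠ k in atTop, ∀ x, ((a * ‖x‖ - b : ℝ) : EReal) ≤ w k x := by
  obtain ⟨x₀, hx₀⟩ := hu.proper
  obtain ⟨m, hm⟩ : ∃ m : ℝ, u x₀ = m := ⟨_, (EReal.coe_toReal hx₀ (hu.ne_bot x₀)).symm⟩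
  obtain ⟨y, hy, hylim⟩ := (h x₀).2
  have hym : ∀ᶠ k in atTop, w k (y k) < ((m + 1 : ℝ) : EReal) := by
    refine eventually_lt_of_limsup_lt (hylim.trans_lt ?_)
    rw [hm]
    exact EReal.coe_lt_coe_iff.2 (by linarith)
  have hyd : ∀ᶠ k in atTop, dist (y k) x₀ < 1 := hy.eventually (Metric.ball_mem_nhds x₀ one_pos)
  obtain ⟨R', hR'⟩ := (Metric.isBounded_iff_subset_closedBall x₀).1
    (hu.isCompact_sublevel (m + 2)).isBounded
  set R := max R' 0 + 2 with hR
  have hR2 : 2 ≤ R := by linarith [le_max_right R' 0]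
  have hshell : ∀ᶠ k in atTop, ∀ x ∈ Metric.closedBall x₀ (R + 1) \ Metric.ball x₀ (R - 1),
      ((m + 2 : ℝ) : EReal) < w k x := by
    refine h.eventually_forall_lt ((isCompact_closedBall _ _).diff Metric.isOpen_ball) ?_
    intro x hx
    by_contra hcon
    have h1 := Metric.mem_closedBall.1 (hR' (not_lt.1 hcon))
    exact hx.2 (Metric.mem_ball.2 (by linarith [le_max_left R' 0]))
  obtain ⟨c, hc⟩ : ∃ c : ℝ, ∀ x ∈ Metric.closedBall x₀ (R + 1), (c : EReal) < u x := by
    obtain ⟨p, -, hp⟩ := (hu.lsc.lowerSemicontinuousOn _).exists_isMinOn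
      (Metric.nonempty_closedBall.2 (by linarith : (0 : ℝ) ≤ R + 1))
      (isCompact_closedBall x₀ (R + 1))
    obtain ⟨c, -, hc⟩ := EReal.lt_iff_exists_real_btwn.1 (bot_lt_iff_ne_bot.2 (hu.ne_bot p))
    exact ⟨c, fun x hx => hc.trans_le (hp hx)⟩
  have hball := h.eventually_forall_lt (isCompact_closedBall x₀ (R + 1)) hc
  have hRpos : 0 < R := by linarith
  -- The quotient absorbs the cone's growth near `x₀`; `|c|` serves the points within `R` of `y k`,
  -- and `|m|` the points beyond.
  refine ⟨1 / R, by positivity, (‖x₀‖ + R + 1) / R + |m| + |c|, ?_⟩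
  filter_upwards [hym, hyd, hshell, hball] with k h1 h2 h3 h4 x
  have hnorm : ‖x‖ ≤ dist x (y k) + 1 + ‖x₀‖ := by
    have e1 := dist_triangle4 x (y k) x₀ 0
    simp only [dist_zero_right] at e1
    linarith
  rcases le_or_gt (dist x (y k)) R with hd | hd
  · have hx : x ∈ Metric.closedBall x₀ (R + 1) := by
      rw [Metric.mem_closedBall]
      linarith [dist_triangle x (y k) x₀]
    refine le_trans (EReal.coe_le_coe_iff.2 ?_) (h4 x hx).le
    have e1 : 1 / R * ‖x‖ ≤ (‖x₀‖ + R + 1) / R := by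
      rw [one_div_mul_eq_div]
      gcongr
      linarith
    linarith [neg_abs_le c, abs_nonneg m]
  · set d := dist x (y k) with hdd
    have hdpos : 0 < d := hRpos.trans hd
    have hl1 : R / d ≤ 1 := (div_le_one hdpos).2 hd.le
    have hl0 : 0 ≤ R / d := by positivity
    -- The point of the segment from `y k` to `x` at distance `R` from `y k` lies in the shell,
    -- since `y k` is within `1` of `x₀`.
    have hz : (1 - R / d) • y k + (R / d) • x ∈
        Metric.closedBall x₀ (R + 1) \ Metric.ball x₀ (R - 1) := by
      have e0 : dist ((1 - R / d) • y k + (R / d) • x) (y k) = R := by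
        have : (1 - R / d) • y k + (R / d) • x - y k = (R / d) • (x - y k) := by module
        rw [dist_eq_norm, this, norm_smul, ← dist_eq_norm, ← hdd, Real.norm_of_nonneg hl0]
        field_simp
      have e1 := dist_triangle ((1 - R / d) • y k + (R / d) • x) (y k) x₀
      have e2 := dist_triangle_right ((1 - R / d) • y k + (R / d) • x) (y k) x₀
      refine ⟨Metric.mem_closedBall.2 (by linarith), fun hmem => ?_⟩
      have := Metric.mem_ball.1 hmem
      linarith
    -- The bound is chosen so that interpolating between it and `m + 1` gives exactly `m + 2` at the
    -- shell point, where `w k` exceeds `m + 2`.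
    have hlow : ((m + 1 + d / R : ℝ) : EReal) < w k x := by
      by_contra hcon
      have e := (hw k).le_combo h1.le (not_lt.1 hcon) (sub_nonneg.2 hl1) hl0 (by ring)
      have e' : (1 - R / d) * (m + 1) + R / d * (m + 1 + d / R) = m + 2 := by
        field_simp
        ring
      rw [e'] at e
      exact (h3 _ hz).not_ge e
    refine le_trans (EReal.coe_le_coe_iff.2 ?_) hlow.le
    have e1 : 1 / R * ‖x‖ ≤ d / R + (‖x₀‖ + R + 1) / R := by
      rw [one_div_mul_eq_div, ← add_div]
      gcongr
      linarith
    linarith [neg_abs_le m, abs_nonneg c]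

/-- Sublevel sets of an epi-convergent sequence converge, except possibly at the minimum of the
limit. -/
theorem EpiConverges.tendsto_hatDH_sublevel (h : EpiConverges w u)
    (hw : ∀ k, IsCoerciveConvex (w k)) (hu : IsCoerciveConvex u) {t : ℝ}
    (ht : ∀ x, u x ≤ t → ∃ z, u z < t) :
    Tendsto (fun k => hatDH {x | w k x ≤ (t : EReal)} {x | u x ≤ (t : EReal)}) atTop (𝓝 0) := by
  obtain ⟨a, ha, b, hab⟩ := h.exists_cone_le hw hu
  have hbdd : ∀ᶠ k in atTop, {x | w k x ≤ (t : EReal)} ⊆ Metric.closedBall 0 ((t + b) / a) := by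
    filter_upwards [hab] with k hk x hx
    have h1 : a * ‖x‖ - b ≤ t := EReal.coe_le_coe_iff.1 ((hk x).trans hx)
    rw [mem_closedBall_zero_iff, le_div_iff₀ ha]
    linarith
  rcases {x | u x ≤ (t : EReal)}.eq_empty_or_nonempty with he | hne
  · have hev := h.eventually_forall_lt (isCompact_closedBall 0 ((t + b) / a)) (c := t)
      fun x _ => not_le.1 fun hx => (he ▸ hx : x ∈ (∅ : Set _))
    refine tendsto_const_nhds.congr' ?_
    filter_upwards [hbdd, hev] with k h1 h2
    have : {x | w k x ≤ (t : EReal)} = ∅ :=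
      Set.eq_empty_of_forall_notMem fun x hx => (h2 x (h1 hx)).not_ge hx
    rw [he, this, hatDH_self]
  · obtain ⟨z, hz⟩ := ht _ hne.some_mem
    rw [Metric.tendsto_nhds]
    intro ε hε
    set S := {x | u x ≤ (t : EReal)} with hS
    have hSc : IsCompact S := hu.isCompact_sublevel t
    have hup : ∀ᶠ k in atTop, ∀ x, w k x ≤ t → ∃ y ∈ S, dist x y ≤ ε / 2 := by
      have hev := h.eventually_forall_lt ((isCompact_closedBall 0 ((t + b) / a)).diff
        (Metric.isOpen_thickening (δ := ε / 2) (E := S))) (c := t) fun x hx =>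
          not_le.1 fun hxS => hx.2 (Metric.self_subset_thickening (by positivity) _ hxS)
      filter_upwards [hbdd, hev] with k h1 h2 x hx
      have hmem : x ∈ Metric.thickening (ε / 2) S := by
        by_contra hcon
        exact (h2 x ⟨h1 hx, hcon⟩).not_ge hx
      obtain ⟨y, hy, hd⟩ := Metric.mem_thickening_iff.1 hmem
      exact ⟨y, hy, hd.le⟩
    have hlo : ∀ᶠ k in atTop, ∀ x ∈ S, ∃ y, w k y ≤ t ∧ dist x y ≤ ε / 2 := by
      obtain ⟨T, hTS, hTf, hcov⟩ := hSc.finite_cover_balls (e := ε / 4) (by positivity)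
      have hT : ∀ᶠ k in atTop, ∀ p ∈ T, ∃ y, w k y ≤ t ∧ dist p y ≤ ε / 4 := by
        rw [eventually_all_finite hTf]
        intro p hp
        -- Moving from `p` to a nearby `q` with `u q < t` leaves room for the recovery sequence of
        -- `q` to enter the sublevel sets at `t` itself.
        obtain ⟨q, hqp, hqt⟩ := hu.exists_dist_lt (hTS hp) hz (ε := ε / 4) (by positivity)
        obtain ⟨y, hy, hylim⟩ := (h q).2
        have hyp : ∀ᶠ k in atTop, y k ∈ Metric.ball p (ε / 4) :=
          hy.eventually (Metric.isOpen_ball.mem_nhds hqp)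
        filter_upwards [eventually_lt_of_limsup_lt (hylim.trans_lt hqt), hyp] with k h1 h2
        exact ⟨y k, h1.le, (Metric.mem_ball'.1 h2).le⟩
      filter_upwards [hT] with k hk x hx
      obtain ⟨p, hp, hxp⟩ := Set.mem_iUnion₂.1 (hcov hx)
      obtain ⟨y, hy, hd⟩ := hk p hp
      exact ⟨y, hy, by linarith [dist_triangle x p y, Metric.mem_ball.1 hxp]⟩
    filter_upwards [hup, hlo] with k h1 h2
    obtain ⟨y, hy, -⟩ := h2 _ hne.some_mem
    rw [hatDH_of_nonempty ⟨y, hy⟩ hne, Real.dist_0_eq_abs,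
      abs_of_nonneg Metric.hausdorffDist_nonneg]
    refine lt_of_le_of_lt ?_ (half_lt_self hε)
    exact Metric.hausdorffDist_le_of_mem_dist (by positivity) h1 h2

end CoerciveConvex

/-! ### Superlevel sets, integrable bounds and dominated convergence. -/

section Superlevel

variable {n : ℕ} {ζ : ℝ → ℝ}

theorem superlevel_antitone (ζ : ℝ → ℝ) (u : EuclideanSpace ℝ (Fin n) → EReal) :
    Antitone (superlevel ζ u) :=
  fun _ _ hst _ hx => hst.trans hx

theorem exists_lt_of_integrableOn_Ioi (hi : IntegrableOn ζ (Set.Ioi 0) volume) {s : ℝ}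
    (hs : 0 < s) : ∃ t, ζ t < s := by
  by_contra! hcon
  have hconst : IntegrableOn (fun _ : ℝ => s) (Set.Ioi 0) volume := by
    refine Integrable.mono' hi aestronglyMeasurable_const (ae_of_all _ fun t => ?_)
    rw [Real.norm_of_nonneg hs.le]
    exact hcon t
  rw [integrableOn_const_iff] at hconst
  simp [hs.ne'] at hconst

/-- For `s > 0` the condition `ζ y ≥ s` is either void or of the form `y ≤ t` with `ζ t = s`. -/
theorem zetaExt_lt_or_exists_le_iff (hc : Continuous ζ) (ha : Antitone ζ)
    (hi : IntegrableOn ζ (Set.Ioi 0) volume) {s : ℝ} (hs : 0 < s) :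
    (∀ y : EReal, y ≠ ⊥ → zetaExt ζ y < s) ∨
      ∃ t : ℝ, ζ t = s ∧ ∀ y : EReal, y ≠ ⊥ → (s ≤ zetaExt ζ y ↔ y ≤ t) := by
  obtain ⟨T, hT⟩ := exists_lt_of_integrableOn_Ioi hi hs
  have hbdd : ∀ r, s ≤ ζ r → r ≤ T := fun r hr => by
    by_contra hcon
    linarith [ha (not_le.1 hcon).le]
  have hclosed : IsClosed {r | s ≤ ζ r} := isClosed_le continuous_const hc
  rcases {r | s ≤ ζ r}.eq_empty_or_nonempty with he | hne
  · left
    intro y hy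
    unfold zetaExt
    split_ifs with h
    · exact hs
    · by_contra hcon
      exact (he ▸ (not_lt.1 hcon : y.toReal ∈ {r | s ≤ ζ r}) : y.toReal ∈ (∅ : Set ℝ))
  · right
    have hb : BddAbove {r | s ≤ ζ r} := ⟨T, hbdd⟩
    set t := sSup {r | s ≤ ζ r} with ht
    have htm : s ≤ ζ t := hclosed.csSup_mem hne hb
    have hle : ∀ r, s ≤ ζ r → r ≤ t := fun r hr => le_csSup hb hr
    refine ⟨t, le_antisymm ?_ htm, fun y hy => ?_⟩
    -- If `ζ t > s`, continuity would keep `ζ > s` slightly to the right of the supremum `t`.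
    · by_contra! hcon
      have hev : ∀ᶠ r in 𝓝[>] t, s < ζ r :=
        nhdsWithin_le_nhds (hc.continuousAt.eventually (lt_mem_nhds hcon))
      obtain ⟨r, hr, hrt⟩ := (hev.and self_mem_nhdsWithin).exists
      exact (hle r hr.le).not_gt hrt
    · unfold zetaExt
      induction y with
      | bot => exact absurd rfl hy
      | top => simp [hs]
      | coe y =>
        simp only [EReal.coe_ne_top, if_false, EReal.toReal_coe, EReal.coe_le_coe_iff]
        exact ⟨hle y, fun h => htm.trans (ha h)⟩

theorem superlevel_eq_empty_or_sublevel (hc : Continuous ζ) (ha : Antitone ζ)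
    (hi : IntegrableOn ζ (Set.Ioi 0) volume) {s : ℝ} (hs : 0 < s) :
    (∀ u : CVc n, superlevel ζ u.1 s = ∅) ∨
      ∃ t : ℝ, ζ t = s ∧ ∀ u : CVc n, superlevel ζ u.1 s = {x | u.1 x ≤ (t : EReal)} := by
  rcases zetaExt_lt_or_exists_le_iff hc ha hi hs with h | ⟨t, hts, h⟩
  · exact Or.inl fun u => Set.eq_empty_of_forall_notMem fun x hx =>
      (h _ (u.2.ne_bot x)).not_ge hx
  · exact Or.inr ⟨t, hts, fun u => Set.ext fun x => h _ (u.2.ne_bot x)⟩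

theorem isCompact_superlevel (hc : Continuous ζ) (ha : Antitone ζ)
    (hi : IntegrableOn ζ (Set.Ioi 0) volume) (u : CVc n) {s : ℝ} (hs : 0 < s) :
    IsCompact (superlevel ζ u.1 s) := by
  rcases superlevel_eq_empty_or_sublevel (n := n) hc ha hi hs with h | ⟨t, -, h⟩
  · rw [h]
    exact isCompact_empty
  · rw [h]
    exact u.2.isCompact_sublevel t

theorem convex_superlevel (hc : Continuous ζ) (ha : Antitone ζ)
    (hi : IntegrableOn ζ (Set.Ioi 0) volume) (u : CVc n) {s : ℝ} (hs : 0 < s) :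
    Convex ℝ (superlevel ζ u.1 s) := by
  rcases superlevel_eq_empty_or_sublevel (n := n) hc ha hi hs with h | ⟨t, -, h⟩
  · rw [h]
    exact convex_empty
  · rw [h]
    exact u.2.convex_sublevel t

/-- The radius of the ball `{x | ζ (a‖x‖ - b) ≥ s}`. -/
noncomputable def coneRadius (ζ : ℝ → ℝ) (a b s : ℝ) : ℝ :=
  (volume.restrict (Set.Ioi 0) {r : ℝ | s ≤ ζ (a * r - b)}).toReal

theorem integrableOn_Ioi_comp_affine (hc : Continuous ζ) (hi : IntegrableOn ζ (Set.Ioi 0) volume)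
    {a : ℝ} (ha : 0 < a) (b : ℝ) :
    IntegrableOn (fun r => ζ (a * r - b)) (Set.Ioi 0) volume := by
  have h1 : IntegrableOn ζ (Set.Ioi (-b)) volume := by
    refine IntegrableOn.mono_set (t := Set.Icc (-b) 0 ∪ Set.Ioi 0)
      ((hc.integrableOn_Icc).union hi) fun x hx => ?_
    rcases le_or_gt x 0 with h | h
    · exact Or.inl ⟨le_of_lt hx, h⟩
    · exact Or.inr h
  have h2 : IntegrableOn (fun r => ζ (r - b)) (Set.Ioi 0) volume := by
    have h := (measurePreserving_sub_right volume b).integrableOn_comp_preimage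
      (MeasurableEquiv.subRight b).measurableEmbedding (f := ζ) (s := Set.Ioi (-b))
    have hpre : (fun r : ℝ => r - b) ⁻¹' Set.Ioi (-b) = Set.Ioi 0 := by
      ext r
      simp
    rw [hpre] at h
    exact h.2 h1
  have h3 := (integrableOn_Ioi_comp_mul_left_iff (fun r => ζ (r - b)) 0 ha).2 (by simpa using h2)
  exact h3

theorem restrict_Ioi_cone_lt_top (hc : Continuous ζ)
    (hi : IntegrableOn ζ (Set.Ioi 0) volume) {a : ℝ} (ha : 0 < a) (b : ℝ) {s : ℝ} (hs : 0 < s) :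
    volume.restrict (Set.Ioi 0) {r : ℝ | s ≤ ζ (a * r - b)} < ⊤ :=
  (integrableOn_Ioi_comp_affine hc hi ha b).measure_ge_lt_top hs

/-- By the layer-cake formula, the integral of the radii over `s` equals that of `ζ (a * r - b)`
over `r > 0`. -/
theorem integrableOn_coneRadius (hc : Continuous ζ) (h0 : ∀ t, 0 ≤ ζ t)
    (hi : IntegrableOn ζ (Set.Ioi 0) volume) {a : ℝ} (ha : 0 < a) (b : ℝ) :
    IntegrableOn (coneRadius ζ a b) (Set.Ioi 0) volume := by
  have hint := integrableOn_Ioi_comp_affine hc hi ha b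
  have hanti : Antitone fun s => volume.restrict (Set.Ioi 0) {r : ℝ | s ≤ ζ (a * r - b)} :=
    fun s t hst => measure_mono fun r hr => hst.trans hr
  refine integrable_toReal_of_lintegral_ne_top hanti.measurable.aemeasurable ?_
  rw [← lintegral_eq_lintegral_meas_le _ (ae_of_all _ fun r => h0 _) hint.aemeasurable]
  exact hint.lintegral_lt_top.ne

theorem norm_le_coneRadius (hc : Continuous ζ) (hanti : Antitone ζ)
    (hi : IntegrableOn ζ (Set.Ioi 0) volume) {a : ℝ} (ha : 0 < a) (b : ℝ) {s r : ℝ} (hs : 0 < s)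
    (h : s ≤ ζ (a * r - b)) : r ≤ coneRadius ζ a b s := by
  have hsub : Set.Ioc 0 r ⊆ {r : ℝ | s ≤ ζ (a * r - b)} := fun q hq => by
    refine h.trans (hanti ?_)
    have := mul_le_mul_of_nonneg_left hq.2 ha.le
    linarith
  have hm := measure_mono (μ := volume.restrict (Set.Ioi 0)) hsub
  rw [Measure.restrict_eq_self _ Set.Ioc_subset_Ioi_self, Real.volume_Ioc, sub_zero] at hm
  exact (ENNReal.ofReal_le_iff_le_toReal (restrict_Ioi_cone_lt_top hc hi ha b hs).ne).1 hm

theorem le_of_mem_superlevel (ha : Antitone ζ) {u : EuclideanSpace ℝ (Fin n) → EReal}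
    {x : EuclideanSpace ℝ (Fin n)} {s t : ℝ} (hs : 0 < s) (hx : x ∈ superlevel ζ u s)
    (ht : (t : EReal) ≤ u x) : s ≤ ζ t := by
  have hx' : s ≤ zetaExt ζ (u x) := hx
  unfold zetaExt at hx'
  split_ifs at hx' with h
  · linarith
  · exact hx'.trans (ha ((EReal.toReal_coe t).symm.le.trans
      (EReal.toReal_le_toReal ht (EReal.coe_ne_bot t) h)))

theorem superlevel_subset_closedBall (hc : Continuous ζ) (hanti : Antitone ζ)
    (hi : IntegrableOn ζ (Set.Ioi 0) volume) {u : EuclideanSpace ℝ (Fin n) → EReal} {a b : ℝ}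
    (ha : 0 < a) (hu : ∀ x, ((a * ‖x‖ - b : ℝ) : EReal) ≤ u x) {s : ℝ} (hs : 0 < s) :
    superlevel ζ u s ⊆ Metric.closedBall 0 (coneRadius ζ a b s) := fun x hx =>
  mem_closedBall_zero_iff.2 (norm_le_coneRadius hc hanti hi ha b hs
    (le_of_mem_superlevel hanti hs hx (hu x)))

/-- An integrable bound for the distance of superlevel sets of functions above a common cone. -/
noncomputable def coneBound (ζ : ℝ → ℝ) (a b : ℝ) : ℝ → ℝ :=
  Set.indicator (Set.Iic (ζ (-b))) fun s => 1 + 2 * coneRadius ζ a b s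

theorem integrableOn_coneBound (hc : Continuous ζ) (h0 : ∀ t, 0 ≤ ζ t)
    (hi : IntegrableOn ζ (Set.Ioi 0) volume) {a : ℝ} (ha : 0 < a) (b : ℝ) :
    IntegrableOn (coneBound ζ a b) (Set.Ioi 0) volume := by
  unfold coneBound
  rw [IntegrableOn, integrable_indicator_iff measurableSet_Iic, IntegrableOn,
    Measure.restrict_restrict measurableSet_Iic, Set.inter_comm, Set.Ioi_inter_Iic]
  exact (integrableOn_const (by simp)).add
    (((integrableOn_coneRadius hc h0 hi ha b).mono_set Set.Ioc_subset_Ioi_self).const_mul 2)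

/-- Above the level `ζ (-b)` both sets are empty, since the cone is at least `-b`. This cutoff keeps
the constant `1` in the bound integrable. -/
theorem hatDH_superlevel_le_coneBound (hc : Continuous ζ) (hanti : Antitone ζ)
    (hi : IntegrableOn ζ (Set.Ioi 0) volume) {u v : EuclideanSpace ℝ (Fin n) → EReal} {a b : ℝ}
    (ha : 0 < a) (hu : ∀ x, ((a * ‖x‖ - b : ℝ) : EReal) ≤ u x)
    (hv : ∀ x, ((a * ‖x‖ - b : ℝ) : EReal) ≤ v x) {s : ℝ} (hs : 0 < s) :
    hatDH (superlevel ζ u s) (superlevel ζ v s) ≤ coneBound ζ a b s := by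
  by_cases hsb : s ≤ ζ (-b)
  · rw [coneBound, Set.indicator_of_mem (Set.mem_Iic.2 hsb)]
    exact hatDH_le_of_subset_closedBall ENNReal.toReal_nonneg
      (superlevel_subset_closedBall hc hanti hi ha hu hs)
      (superlevel_subset_closedBall hc hanti hi ha hv hs)
  · have key : ∀ f : EuclideanSpace ℝ (Fin n) → EReal,
        (∀ x, ((a * ‖x‖ - b : ℝ) : EReal) ≤ f x) → superlevel ζ f s = ∅ := fun f hf =>
      Set.eq_empty_of_forall_notMem fun x hx => hsb <| (le_of_mem_superlevel hanti hs hx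
        (hf x)).trans (hanti (by linarith [mul_nonneg ha.le (norm_nonneg x)]))
    rw [coneBound, Set.indicator_of_notMem (by simpa using hsb), key u hu, key v hv, hatDH_self]

theorem aestronglyMeasurable_hatDH_superlevel (hc : Continuous ζ) (hanti : Antitone ζ)
    (hi : IntegrableOn ζ (Set.Ioi 0) volume) (u v : CVc n) :
    AEStronglyMeasurable (fun s => hatDH (superlevel ζ u.1 s) (superlevel ζ v.1 s))
      (volume.restrict (Set.Ioi 0)) :=
  aestronglyMeasurable_hatDH (superlevel_antitone ζ u.1) (superlevel_antitone ζ v.1)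
    (fun _ hs => isCompact_superlevel hc hanti hi u hs)
    fun _ hs => isCompact_superlevel hc hanti hi v hs

theorem cone_le_cone {a a' b b' r : ℝ} (ha : a' ≤ a) (hb : b ≤ b') (hr : 0 ≤ r) :
    ((a' * r - b' : ℝ) : EReal) ≤ ((a * r - b : ℝ) : EReal) :=
  EReal.coe_le_coe_iff.2 (by linarith [mul_le_mul_of_nonneg_right ha hr])

theorem exists_common_cone {w : ℕ → CVc n} {u v : CVc n}
    (h : EpiConverges (fun k => (w k).1) u.1) :
    ∃ a : ℝ, 0 < a ∧ ∃ b : ℝ, (∀ x, ((a * ‖x‖ - b : ℝ) : EReal) ≤ v.1 x) ∧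
      ∀ᶠ k in atTop, ∀ x, ((a * ‖x‖ - b : ℝ) : EReal) ≤ (w k).1 x := by
  obtain ⟨a, ha, b, hab⟩ := h.exists_cone_le (fun k => (w k).2) u.2
  obtain ⟨a', ha', b', hab'⟩ := (EpiConverges.const v.2.lsc).exists_cone_le (fun _ => v.2) v.2
  obtain ⟨-, hv⟩ := hab'.exists
  refine ⟨min a a', lt_min ha ha', max b b', fun x => ?_, hab.mono fun k hk x => ?_⟩
  · exact (cone_le_cone (min_le_right _ _) (le_max_right _ _) (norm_nonneg x)).trans (hv x)
  · exact (cone_le_cone (min_le_left _ _) (le_max_left _ _) (norm_nonneg x)).trans (hk x)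

theorem integrableOn_hatDH_superlevel (hc : Continuous ζ) (hanti : Antitone ζ)
    (h0 : ∀ t, 0 ≤ ζ t) (hi : IntegrableOn ζ (Set.Ioi 0) volume) (u v : CVc n) :
    IntegrableOn (fun s => hatDH (superlevel ζ u.1 s) (superlevel ζ v.1 s))
      (Set.Ioi 0) volume := by
  obtain ⟨a, ha, b, hv, hu⟩ := exists_common_cone (v := v) (EpiConverges.const u.2.lsc)
  obtain ⟨-, hu⟩ := hu.exists
  refine Integrable.mono' (integrableOn_coneBound hc h0 hi ha b)
    (aestronglyMeasurable_hatDH_superlevel hc hanti hi u v) ?_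
  filter_upwards [ae_restrict_mem measurableSet_Ioi] with s hs
  rw [Real.norm_of_nonneg (hatDH_nonneg _ _)]
  exact hatDH_superlevel_le_coneBound hc hanti hi ha hu hv hs

theorem EpiConverges.tendsto_deltaH (hc : Continuous ζ) (hanti : Antitone ζ)
    (h0 : ∀ t, 0 ≤ ζ t) (hi : IntegrableOn ζ (Set.Ioi 0) volume) {w : ℕ → CVc n} {u : CVc n}
    (h : EpiConverges (fun k => (w k).1) u.1) :
    Tendsto (fun k => deltaH ζ (w k) u) atTop (𝓝 0) := by
  obtain ⟨a, ha, b, hu, hw⟩ := exists_common_cone (v := u) h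
  have hzero : (0 : ℝ) = ∫ s in Set.Ioi (0 : ℝ), (0 : ℝ) := by simp
  rw [hzero]
  refine tendsto_integral_filter_of_dominated_convergence (coneBound ζ a b)
    (Eventually.of_forall fun k => aestronglyMeasurable_hatDH_superlevel hc hanti hi (w k) u)
    ?_ (integrableOn_coneBound hc h0 hi ha b) ?_
  · filter_upwards [hw] with k hk
    filter_upwards [ae_restrict_mem measurableSet_Ioi] with s hs
    rw [Real.norm_of_nonneg (hatDH_nonneg _ _)]
    exact hatDH_superlevel_le_coneBound hc hanti hi ha hk hu hs
  -- The only level at which convergence may fail is `s = ζ t` with `t = min u`: a single point,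
  -- hence null.
  · have hex : {s : ℝ | ∃ t : ℝ, ζ t = s ∧ (∃ x, u.1 x ≤ t) ∧
        ∀ x, (t : EReal) ≤ u.1 x}.Subsingleton := by
      rintro s ⟨t, rfl, ⟨x, hx⟩, ht⟩ s' ⟨t', rfl, ⟨x', hx'⟩, ht'⟩
      have h1 := EReal.coe_le_coe_iff.1 ((ht x').trans hx')
      have h2 := EReal.coe_le_coe_iff.1 ((ht' x).trans hx)
      rw [le_antisymm h1 h2]
    filter_upwards [ae_restrict_mem measurableSet_Ioi,
      ae_restrict_of_ae (measure_eq_zero_iff_ae_notMem.1 (hex.measure_zero volume))] with s hs hne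
    rcases superlevel_eq_empty_or_sublevel (n := n) hc hanti hi hs with hlev | ⟨t, hts, hlev⟩
    · simp [hlev, hatDH_self]
    · simp only [hlev]
      refine h.tendsto_hatDH_sublevel (fun k => (w k).2) u.2 fun x hx => ?_
      by_contra! hcon
      exact hne ⟨t, hts, ⟨x, hx⟩, hcon⟩

end Superlevel

/-! ### From convergence of `deltaH` to epi-convergence. -/

section Converse

/-- Diagonal argument: `φ k` is the greatest `m ≤ k` with `P m k`. -/
theorem exists_tendsto_atTop_eventually_diag {P : ℕ → ℕ → Prop}
    (h : ∀ m, ∀ᶠ k in atTop, P m k) :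
    ∃ φ : ℕ → ℕ, Tendsto φ atTop atTop ∧ ∀ᶠ k in atTop, P (φ k) k := by
  classical
  refine ⟨fun k => Nat.findGreatest (fun m => P m k) k, tendsto_atTop.2 fun M => ?_, ?_⟩
  · filter_upwards [h M, eventually_ge_atTop M] with k hk hMk
    exact Nat.le_findGreatest hMk hk
  · filter_upwards [h 0] with k hk
    exact Nat.findGreatest_spec (P := fun m => P m k) (Nat.zero_le k) hk

variable {n : ℕ} {ζ : ℝ → ℝ}

theorem mem_superlevel_of_le (ha : Antitone ζ) (u : CVc n) {x : EuclideanSpace ℝ (Fin n)}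
    {s t : ℝ} (hx : u.1 x ≤ t) (hs : s ≤ ζ t) : x ∈ superlevel ζ u.1 s := by
  have htop : u.1 x ≠ ⊤ := (hx.trans_lt (EReal.coe_lt_top t)).ne
  change s ≤ zetaExt ζ (u.1 x)
  rw [zetaExt, if_neg htop]
  exact hs.trans (ha ((EReal.toReal_le_toReal hx (u.2.ne_bot x) (EReal.coe_ne_top t)).trans
    (EReal.toReal_coe t).le))

theorem lt_of_mem_superlevel (ha : Antitone ζ) {u : EuclideanSpace ℝ (Fin n) → EReal}
    {x : EuclideanSpace ℝ (Fin n)} {s t : ℝ} (hs : 0 < s) (hx : x ∈ superlevel ζ u s)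
    (ht : ζ t < s) : u x < t := by
  by_contra hcon
  exact ht.not_ge (le_of_mem_superlevel ha hs hx (not_lt.1 hcon))

theorem deltaH_self (ζ : ℝ → ℝ) (u : CVc n) : deltaH ζ u u = 0 := by
  simp [deltaH, hatDH_self]

theorem deltaH_comm (ζ : ℝ → ℝ) (u v : CVc n) : deltaH ζ u v = deltaH ζ v u := by
  simp only [deltaH, hatDH_comm]

theorem deltaH_triangle (hc : Continuous ζ) (ha : Antitone ζ) (h0 : ∀ t, 0 ≤ ζ t)
    (hi : IntegrableOn ζ (Set.Ioi 0) volume) (u v w : CVc n) :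
    deltaH ζ u w ≤ deltaH ζ u v + deltaH ζ v w := by
  have huv := integrableOn_hatDH_superlevel hc ha h0 hi u v
  have hvw := integrableOn_hatDH_superlevel hc ha h0 hi v w
  unfold deltaH
  rw [← integral_add huv hvw]
  refine setIntegral_mono_on (integrableOn_hatDH_superlevel hc ha h0 hi u w) (huv.add hvw)
    measurableSet_Ioi fun s hs => ?_
  exact hatDH_triangle (isCompact_superlevel hc ha hi u hs) (isCompact_superlevel hc ha hi v hs)
    (isCompact_superlevel hc ha hi w hs)

theorem mul_sub_le_deltaH (hc : Continuous ζ) (ha : Antitone ζ) (h0 : ∀ t, 0 ≤ ζ t)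
    (hi : IntegrableOn ζ (Set.Ioi 0) volume) (u v : CVc n) {ε s₁ s₂ : ℝ} (h₁ : 0 ≤ s₁)
    (h₁₂ : s₁ ≤ s₂)
    (h : ∀ s ∈ Set.Ioc s₁ s₂, ε ≤ hatDH (superlevel ζ u.1 s) (superlevel ζ v.1 s)) :
    ε * (s₂ - s₁) ≤ deltaH ζ u v := by
  have hint := integrableOn_hatDH_superlevel hc ha h0 hi u v
  have hsub : Set.Ioc s₁ s₂ ⊆ Set.Ioi 0 := fun s hs => h₁.trans_lt hs.1
  calc ε * (s₂ - s₁) = ∫ _ in Set.Ioc s₁ s₂, ε := by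
        simp [Real.volume_real_Ioc_of_le h₁₂, mul_comm]
    _ ≤ ∫ s in Set.Ioc s₁ s₂, hatDH (superlevel ζ u.1 s) (superlevel ζ v.1 s) :=
        setIntegral_mono_on (integrableOn_const (by simp)) (hint.mono_set hsub)
          measurableSet_Ioc h
    _ ≤ deltaH ζ u v :=
        setIntegral_mono_set hint (ae_of_all _ fun s => hatDH_nonneg _ _)
          (Eventually.of_forall hsub)

/-- Otherwise pick `liminf < t < t' < u x`. By semicontinuity `u > t'` on a ball about `x`, so for
infinitely many `k` the point `y k` is in the superlevel set of `w k` but far from that of `u`, for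
all `s` in `(ζ t', ζ t]`. -/
theorem le_liminf_of_tendsto_deltaH (hc : Continuous ζ) (ha : StrictAnti ζ) (h0 : ∀ t, 0 < ζ t)
    (hi : IntegrableOn ζ (Set.Ioi 0) volume) {w : ℕ → CVc n} {u : CVc n}
    (h : Tendsto (fun k => deltaH ζ (w k) u) atTop (𝓝 0)) {x : EuclideanSpace ℝ (Fin n)}
    {y : ℕ → EuclideanSpace ℝ (Fin n)} (hy : Tendsto y atTop (𝓝 x)) :
    u.1 x ≤ liminf (fun k => (w k).1 (y k)) atTop := by
  by_contra! hcon
  obtain ⟨t, ht, htu⟩ := EReal.lt_iff_exists_real_btwn.1 hcon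
  obtain ⟨t', htt', htu'⟩ := EReal.lt_iff_exists_real_btwn.1 htu
  have hlt : ζ t' < ζ t := ha (EReal.coe_lt_coe_iff.1 htt')
  have hopen : IsOpen {z | (t' : EReal) < u.1 z} := u.2.lsc.isOpen_preimage _
  obtain ⟨δ, hδ, hball⟩ := Metric.isOpen_iff.1 hopen x htu'
  have hε : 0 < min 1 (δ / 2) := lt_min one_pos (by positivity)
  have hsmall := h.eventually (gt_mem_nhds (mul_pos hε (sub_pos.2 hlt)))
  obtain ⟨k, hk, hkδ, hkd⟩ := ((frequently_lt_of_liminf_lt (by isBoundedDefault) ht).and_eventually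
    (hsmall.and (hy.eventually (Metric.ball_mem_nhds x (half_pos hδ))))).exists
  refine hkδ.not_ge (mul_sub_le_deltaH hc ha.antitone (fun t => (h0 t).le) hi (w k) u
    (h0 t').le hlt.le fun s hs => ?_)
  have hs0 : 0 < s := (h0 t').trans hs.1
  refine le_hatDH (isCompact_superlevel hc ha.antitone hi (w k) hs0)
    (isCompact_superlevel hc ha.antitone hi u hs0)
    (mem_superlevel_of_le ha.antitone (w k) hk.le hs.2) (min_le_left _ _) fun z hz => ?_
  have hzt := lt_of_mem_superlevel ha.antitone hs0 hz hs.1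
  have hzx : δ ≤ dist z x := not_lt.1 fun hlt => (hball (Metric.mem_ball.2 hlt)).not_gt hzt
  have hkd' : dist (y k) x < δ / 2 := hkd
  linarith [min_le_right 1 (δ / 2), dist_triangle_left z x (y k)]

/-- The loss of `ε` in the value opens the interval `(ζ (t + ε), ζ t]`, on which `x` would stay
`ε`-far from the superlevel sets of `w k`. -/
theorem eventually_exists_near_of_tendsto_deltaH (hc : Continuous ζ) (ha : StrictAnti ζ)
    (h0 : ∀ t, 0 < ζ t) (hi : IntegrableOn ζ (Set.Ioi 0) volume) {w : ℕ → CVc n} {u : CVc n}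
    (h : Tendsto (fun k => deltaH ζ (w k) u) atTop (𝓝 0)) {x : EuclideanSpace ℝ (Fin n)} {t : ℝ}
    (hx : u.1 x ≤ t) {ε : ℝ} (hε : 0 < ε) (hε1 : ε ≤ 1) :
    ∀ᶠ k in atTop, ∃ y, dist y x < ε ∧ (w k).1 y ≤ ((t + ε : ℝ) : EReal) := by
  have hlt : ζ (t + ε) < ζ t := ha (by linarith)
  filter_upwards [h.eventually (gt_mem_nhds (mul_pos hε (sub_pos.2 hlt)))] with k hk
  by_contra! hcon
  refine hk.not_ge (mul_sub_le_deltaH hc ha.antitone (fun t => (h0 t).le) hi (w k) u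
    (h0 (t + ε)).le hlt.le fun s hs => ?_)
  have hs0 : 0 < s := (h0 _).trans hs.1
  rw [hatDH_comm]
  refine le_hatDH (isCompact_superlevel hc ha.antitone hi u hs0)
    (isCompact_superlevel hc ha.antitone hi (w k) hs0)
    (mem_superlevel_of_le ha.antitone u hx hs.2) hε1 fun z hz => ?_
  have hzt := lt_of_mem_superlevel ha.antitone hs0 hz hs.1
  rw [dist_comm]
  exact not_lt.1 fun hlt => (hcon z hlt).not_ge hzt.le

theorem epiConverges_of_tendsto_deltaH (hc : Continuous ζ) (ha : StrictAnti ζ)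
    (h0 : ∀ t, 0 < ζ t) (hi : IntegrableOn ζ (Set.Ioi 0) volume) {w : ℕ → CVc n} {u : CVc n}
    (h : Tendsto (fun k => deltaH ζ (w k) u) atTop (𝓝 0)) :
    EpiConverges (fun k => (w k).1) u.1 := by
  refine fun x => ⟨fun y hy => le_liminf_of_tendsto_deltaH hc ha h0 hi h hy, ?_⟩
  by_cases htop : u.1 x = ⊤
  · exact ⟨fun _ => x, tendsto_const_nhds, htop ▸ le_top⟩
  obtain ⟨t, ht⟩ : ∃ t : ℝ, u.1 x = t := ⟨_, (EReal.coe_toReal htop (u.2.ne_bot x)).symm⟩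
  obtain ⟨φ, hφ, hP⟩ := exists_tendsto_atTop_eventually_diag fun m : ℕ =>
    eventually_exists_near_of_tendsto_deltaH hc ha h0 hi h ht.le
      (Nat.one_div_pos_of_nat (n := m) (α := ℝ))
      (by rw [div_le_one (by positivity)]; linarith [Nat.cast_nonneg (α := ℝ) m])
  have hlim : Tendsto (fun k => 1 / ((φ k : ℝ) + 1)) atTop (𝓝 0) :=
    tendsto_one_div_add_atTop_nhds_zero_nat.comp hφ
  -- Good points exist only eventually; the implication lets one sequence be chosen for all `k`,
  -- with `x` as default.
  have hchoice : ∀ k, ∃ y, (∃ y, dist y x < 1 / ((φ k : ℝ) + 1) ∧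
      (w k).1 y ≤ ((t + 1 / ((φ k : ℝ) + 1) : ℝ) : EReal)) →
      dist y x < 1 / ((φ k : ℝ) + 1) ∧ (w k).1 y ≤ ((t + 1 / ((φ k : ℝ) + 1) : ℝ) : EReal) :=
    fun k => by
      by_cases hk : ∃ y, dist y x < 1 / ((φ k : ℝ) + 1) ∧
        (w k).1 y ≤ ((t + 1 / ((φ k : ℝ) + 1) : ℝ) : EReal)
      · exact ⟨hk.choose, fun _ => hk.choose_spec⟩
      · exact ⟨x, fun hk' => absurd hk' hk⟩
  choose y hy using hchoice
  refine ⟨y, tendsto_iff_dist_tendsto_zero.2 (squeeze_zero' (Eventually.of_forall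
    fun _ => dist_nonneg) (hP.mono fun k hk => (hy k hk).1.le) hlim), ?_⟩
  have hlim' : Tendsto (fun k => ((t + 1 / ((φ k : ℝ) + 1) : ℝ) : EReal)) atTop (𝓝 (u.1 x)) := by
    rw [ht]
    refine (continuous_coe_real_ereal.tendsto t).comp ?_
    simpa using tendsto_const_nhds.add hlim
  rw [← hlim'.limsup_eq]
  exact limsup_le_limsup (hP.mono fun k hk => (hy k hk).2)

theorem le_of_deltaH_eq_zero (hc : Continuous ζ) (ha : StrictAnti ζ) (h0 : ∀ t, 0 < ζ t)
    (hi : IntegrableOn ζ (Set.Ioi 0) volume) {u v : CVc n} (h : deltaH ζ u v = 0) :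
    v.1 ≤ u.1 := fun x => by
  have hlim : Tendsto (fun _ : ℕ => deltaH ζ u v) atTop (𝓝 0) := h ▸ tendsto_const_nhds
  simpa using le_liminf_of_tendsto_deltaH hc ha h0 hi hlim (tendsto_const_nhds (x := x))

theorem eq_of_deltaH_eq_zero (hc : Continuous ζ) (ha : StrictAnti ζ) (h0 : ∀ t, 0 < ζ t)
    (hi : IntegrableOn ζ (Set.Ioi 0) volume) {u v : CVc n} (h : deltaH ζ u v = 0) : u = v :=
  Subtype.ext (le_antisymm (le_of_deltaH_eq_zero hc ha h0 hi (deltaH_comm ζ u v ▸ h))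
    (le_of_deltaH_eq_zero hc ha h0 hi h))

end Converse

theorem mainTheorem4 (n : ℕ) :
    -- `hatDH` is a metric on convex bodies and the empty set, and extends the Hausdorff metric
    ((∃ m : MetricSpace (CompactConvex n),
        ∀ K L : CompactConvex n, m.dist K L = hatDH K.1 L.1) ∧
      ∀ K L : CompactConvex n, K.1.Nonempty → L.1.Nonempty →
        hatDH K.1 L.1 = Metric.hausdorffDist K.1 L.1) ∧
    -- decreasing `ζ`: `deltaH` is well defined and finite, and epi-convergence implies convergence
    (∀ ζ : ℝ → ℝ, Continuous ζ → Antitone ζ → (∀ t, 0 ≤ ζ t) →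
      IntegrableOn ζ (Set.Ioi 0) volume →
      (∀ (u : CVc n) (s : ℝ), 0 < s →
        IsCompact (superlevel ζ u.1 s) ∧ Convex ℝ (superlevel ζ u.1 s)) ∧
      (∀ u v : CVc n,
        IntegrableOn (fun s => hatDH (superlevel ζ u.1 s) (superlevel ζ v.1 s))
          (Set.Ioi 0) volume) ∧
      ∀ (w : ℕ → CVc n) (u : CVc n), EpiConverges (fun k => (w k).1) u.1 →
        Tendsto (fun k => deltaH ζ (w k) u) atTop (𝓝 0)) ∧
    -- strictly decreasing, positive `ζ`: `deltaH` is a metric that induces epi-convergence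
    (∀ ζ : ℝ → ℝ, Continuous ζ → StrictAnti ζ → (∀ t, 0 < ζ t) →
      IntegrableOn ζ (Set.Ioi 0) volume →
      (∃ m : MetricSpace (CVc n), ∀ u v : CVc n, m.dist u v = deltaH ζ u v) ∧
      ∀ (w : ℕ → CVc n) (u : CVc n),
        Tendsto (fun k => deltaH ζ (w k) u) atTop (𝓝 0) ↔
          EpiConverges (fun k => (w k).1) u.1) := by
  refine ⟨⟨⟨{ dist := fun K L => hatDH K.1 L.1
              dist_self := fun K => hatDH_self K.1
              dist_comm := fun K L => hatDH_comm K.1 L.1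
              dist_triangle := fun K L M => hatDH_triangle K.2.1 L.2.1 M.2.1
              eq_of_dist_eq_zero := fun {K L} h =>
                Subtype.ext (eq_of_hatDH_eq_zero K.2.1 L.2.1 h) }, fun _ _ => rfl⟩,
      fun K L hK hL => hatDH_of_nonempty hK hL⟩, ?_, ?_⟩
  · intro ζ hc ha h0 hi
    exact ⟨fun u s hs => ⟨isCompact_superlevel hc ha hi u hs, convex_superlevel hc ha hi u hs⟩,
      integrableOn_hatDH_superlevel hc ha h0 hi, fun w u h => h.tendsto_deltaH hc ha h0 hi⟩
  · intro ζ hc ha h0 hi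
    have h0' : ∀ t, 0 ≤ ζ t := fun t => (h0 t).le
    exact ⟨⟨{ dist := deltaH ζ
              dist_self := deltaH_self ζ
              dist_comm := deltaH_comm ζ
              dist_triangle := deltaH_triangle hc ha.antitone h0' hi
              eq_of_dist_eq_zero := eq_of_deltaH_eq_zero hc ha h0 hi }, fun _ _ => rfl⟩,
      fun w u => ⟨epiConverges_of_tendsto_deltaH hc ha h0 hi,
        fun h => h.tendsto_deltaH hc ha.antitone h0' hi⟩⟩
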